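/- Let $\Sigma$ be a finite alphabet with $|\Sigma|\ge 3$, let $a\in\Sigma$, and let $\mathcal F=\{\mathbf z_1,\mathbf z_2\}$ with $\mathbf z_1=a^n$ and $\mathbf z_2=a\mathbf x$, where $\mathbf x\in\Sigma^{n-1}$ and $\mathbf x\ne a^{n-1}$. Write $\epsilon$ for the empty word and $\ell(\mathbf u)$ for the length of a word $\mathbf u$. Let $\mathcal S_{\mathcal F}$ be the set of all finite words over $\Sigma$ that contain no word of $\mathcal F$ as a subword (block of consecutive symbols). Let $\mathcal V$ be the set of prefixes (including $\epsilon$ and the full words) of $\mathbf z_1$ and $\mathbf z_2$, and for $\mathbf u\in\mathcal V\setminus\mathcal F$, $c\in\Sigma$ let $\delta(\mathbf u,c)$ be the longest suffix of $\mathbf uc$ that lies in $\mathcal V$. The CMR presentation $\mathcal G_{\mathcal F}$ is the labeled graph with state set $\mathcal V\setminus\mathcal F$ and with an edge labeled $c$ from $\mathbf u$ to $\delta(\mathbf u,c)$ whenever $\delta(\mathbf u,c)\notin\mathcal F$. A state $\mathbf u$ is said to be at level $\ell(\mathbf u)$. The failure function $f$ on nonempty states of $\mathcal G_{\mathcal F}$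 is given by $f(c)=\epsilon$ for a single symbol $c$ and $f(\mathbf uc)=\delta(f(\mathbf u),c)$ for $\mathbf u\neq\epsilon$; $f^r$ denotes its $r$th iterate. Parse $\mathbf z_2$ (uniquely) as $$\mathbf z_2=a^{x_1}\beta^{(1)}a^{x_2}\beta^{(2)}\cdots a^{x_{q-1}}\beta^{(q-1)}a^{x_q},$$ with $q\ge 2$, $x_1,\dots,x_{q-1}\ge 1$, $x_q\ge 0$, and each $\beta^{(j)}$ a nonempty word over $\Sigma\setminus\{a\}$. Put $\mathbf p_0=a$ and $\mathbf p_j=a^{x_1}\beta^{(1)}\cdots a^{x_j}\beta^{(j)}a$ for $1\le j\le q-1$. Suppose that $x_1<x_q$. Let $$\mathrm{Ind}_f=\{k\in\{0,\dots,q-1\}:\ f^r(\mathbf p_{q-1})=\mathbf p_k\text{ for some } r\ge 1\},$$ $$\mathcal X=\{x_{k+1}:\ k\in\mathrm{Ind}_f,\ k>0,\ x_1\le x_{k+1}<x_q\},$$ and let $x^*=\max\mathcal X$ if $\mathcal X\neq\emptyset$, and $x^*=x_1-1$ otherwise. The follower set of a state is the set of words read off along paths starting at that state, and two states are follower-set equivalent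 if they have the same follower set. A Shannon cover of a set $\mathcal S$ of words is a finite labeled graph that is deterministic (the edges leaving any one state are labeled distinctly), that presents $\mathcal S$ (the words read off along its paths are exactly those in $\mathcal S$), and that has the smallest number of states among all finite deterministic labeled graphs presenting $\mathcal S$. Merging a state $t$ into a state $s$ means deleting the edges leaving $t$, redirecting into $s$ the remaining edges entering $t$, and deleting $t$. Then, for every $l$ with $\ell(\mathbf p_1)\le l\le n-1$, the states of $\mathcal G_{\mathcal F}$ at level $l$ are follower-set equivalent if and only if $l\ge \ell(\mathbf p_{q-1})+x^*$. Consequently, the graph obtained from $\mathcal G_{\mathcal F}$ by merging the pair of states at each level $l\ge\ell(\mathbf p_{q-1})+x^*$ (whichever state of each pair is kept) is the Shannon cover of $\mathcal S_{\mathcal F}$, which is unique up to isomorphism of labeled graphs. -/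

import Mathlib

noncomputable section

open scoped Classical

namespace CMR

universe u v w

/-! ### Labeled graphs, constrained systems, Shannon covers -/

/-- A labeled graph with state set `V` and labels in `α`: `Edge s c t` says that there is an edge
from `s` to `t` labeled `c`.  (Finiteness of `V` is imposed where it is needed.) -/
structure LabeledGraph (α : Type u) (V : Type v) where
  Edge : V → α → V → Prop

namespace LabeledGraph

variable {α : Type u} {V : Type v} {W : Type w}

/-- There is a path from `s` to `t` along which the word read off is the given one. -/
def Path (G : LabeledGraph α V) : V → List α → V → Prop
  | s, [], t => s = t
  | s, c :: w, t => ∃ s', G.Edge s c s' ∧ G.Path s' w t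

/-- The follower set of `s`: all words generated by paths starting at `s`. -/
def followerSet (G : LabeledGraph α V) (s : V) : Set (List α) :=
  {w | ∃ t, G.Path s w t}

/-- The constrained system presented by `G`: all words generated by paths of `G`. -/
def system (G : LabeledGraph α V) : Set (List α) :=
  {w | ∃ s, w ∈ G.followerSet s}

/-- At each state the outgoing edges are labeled distinctly. -/
def Deterministic (G : LabeledGraph α V) : Prop :=
  ∀ s c t t', G.Edge s c t → G.Edge s c t' → t = t'

/-- `G` is a Shannon cover of `S`: it is a (finite) deterministic presentation of `S`, with the
smallest number of states among all (finite) deterministic presentations of `S`. -/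
def IsShannonCover (G : LabeledGraph α V) (S : Set (List α)) : Prop :=
  Finite V ∧ G.Deterministic ∧ G.system = S ∧
    ∀ (W : Type) [Finite W] (H : LabeledGraph α W),
      H.Deterministic → H.system = S → Nat.card V ≤ Nat.card W

/-- Isomorphism of labeled graphs. -/
def Isomorphic (G : LabeledGraph α V) (H : LabeledGraph α W) : Prop :=
  ∃ e : V ≃ W, ∀ s c t, G.Edge s c t ↔ H.Edge (e s) c (e t)

/-- `r` chooses one representative from each class of the equivalence relation `E`. -/
def IsSelection (E : Setoid V) (r : V → V) : Prop :=
  (∀ s, E s (r s)) ∧ ∀ s t, E s t → r s = r t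

/-- State merging along a choice `r` of representatives: every state `t` with `r t ≠ t` is
eliminated together with the edges emanating from it, and the remaining edges entering `t` are
redirected into `r t`. -/
def merge (G : LabeledGraph α V) (r : V → V) : LabeledGraph α {s : V // r s = s} where
  Edge s c s' := ∃ t, G.Edge s c t ∧ r t = s'

end LabeledGraph

/-! ### Finite-type constraints and the CMR presentation -/

section Presentation

variable {α : Type u}

/-- The finite-type constrained system with forbidden set `F`: the words having no subword
in `F`. -/
def ftcs (F : Set (List α)) : Set (List α) :=
  {w | ∀ x ∈ F, ¬ x <:+: w}

/-- States of the CMR automaton: prefixes (possibly empty or full) of words in `F`. -/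
def IsState (F : Set (List α)) (u : List α) : Prop :=
  ∃ w ∈ F, u <+: w

/-- The transition function `δ(u, c)` of the CMR automaton: the longest suffix of `uc` that is
a state.  This is `uc` itself (a forward edge) if `uc` is a state.  `List.tails` lists the
suffixes of a word from the longest to the empty one. -/
def transition (F : Set (List α)) (u : List α) (c : α) : List α :=
  ((u ++ [c]).tails.find? (fun v => decide (IsState F v))).getD []

/-- The failure function, `f(c) = ε` and `f(uc) = δ(f(u), c)` for `u ≠ ε`, unfolded from left
to right; see `failureFn_singleton` and `failureFn_append`.  It is meant for nonempty states; the
value at `ε` is a placeholder. -/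
def failureFn (F : Set (List α)) : List α → List α
  | [] => []
  | _ :: u => u.foldl (transition F) []

theorem failureFn_singleton (F : Set (List α)) (c : α) : failureFn F [c] = [] := rfl

theorem failureFn_append (F : Set (List α)) (u : List α) (hu : u ≠ []) (c : α) :
    failureFn F (u ++ [c]) = transition F (failureFn F u) c := by
  cases u with
  | nil => exact absurd rfl hu
  | cons d u => simp [failureFn]

/-- States of the CMR presentation: the sink states (words of `F`) are deleted. -/
abbrev State (F : Set (List α)) : Type u := {u : List α // IsState F u ∧ u ∉ F}

/-- The CMR presentation: the CMR automaton without its sink states and the edges entering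
them. -/
def cmr (F : Set (List α)) : LabeledGraph α (State F) where
  Edge s c t := t.1 = transition F s.1 c

/-- The set of states at level `l`, that is, the states that are words of length `l`. -/
def level (F : Set (List α)) (l : ℕ) : Set (State F) :=
  {s | s.1.length = l}

/-- The equivalence relation that identifies two states iff they are equal, or they are at the
same level `l` with `l ≥ L`. -/
def levelSetoid (F : Set (List α)) (L : ℕ) : Setoid (State F) where
  r s t := s = t ∨ (s.1.length = t.1.length ∧ L ≤ s.1.length)
  iseqv :=
    { refl := fun _ => Or.inl rfl
      symm := by
        rintro s t (h | ⟨h, h'⟩)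
        · exact Or.inl h.symm
        · exact Or.inr ⟨h.symm, h ▸ h'⟩
      trans := by
        rintro s t r (rfl | ⟨h, h'⟩) (rfl | ⟨k, k'⟩)
        · exact Or.inl rfl
        · exact Or.inr ⟨k, k'⟩
        · exact Or.inr ⟨h, h'⟩
        · exact Or.inr ⟨h.trans k, h'⟩ }

/-! ### The parse of the second forbidden word -/

/-- The word `a^{x_1} β^{(1)} a^{x_2} β^{(2)} … a^{x_j} β^{(j)}` (empty for `j = 0`). -/
def blocks (a : α) (x : ℕ → ℕ) (β : ℕ → List α) (j : ℕ) : List α :=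
  (List.range j).flatMap fun i => List.replicate (x (i + 1)) a ++ β (i + 1)

/-- `z = a^{x_1} β^{(1)} … a^{x_{q-1}} β^{(q-1)} a^{x_q}` with `q ≥ 2`, where
`x_1, …, x_{q-1}` are positive and `β^{(1)}, …, β^{(q-1)}` are nonempty words over the alphabet
without `a`.  Only `x_1, …, x_q` and `β^{(1)}, …, β^{(q-1)}` matter. -/
structure IsParse (a : α) (z : List α) (q : ℕ) (x : ℕ → ℕ) (β : ℕ → List α) : Prop where
  two_le : 2 ≤ q
  pos : ∀ j, 1 ≤ j → j < q → 0 < x j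
  ne_nil : ∀ j, 1 ≤ j → j < q → β j ≠ []
  notMem : ∀ j, 1 ≤ j → j < q → a ∉ β j
  eq : z = blocks a x β (q - 1) ++ List.replicate (x q) a

/-- The distinguished prefix `p_j = a^{x_1} β^{(1)} … a^{x_j} β^{(j)} a`; `p_0 = a`. -/
def pref (a : α) (x : ℕ → ℕ) (β : ℕ → List α) (j : ℕ) : List α :=
  blocks a x β j ++ [a]

/-- `Ind_f`: the indices `k ∈ {0, …, q-1}` such that `f^r(p_{q-1}) = p_k` for some `r ≥ 1`. -/
def indF (F : Set (List α)) (a : α) (q : ℕ) (x : ℕ → ℕ) (β : ℕ → List α) : Set ℕ :=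
  {k | k < q ∧ ∃ r, 1 ≤ r ∧ (failureFn F)^[r] (pref a x β (q - 1)) = pref a x β k}

/-- The set `𝒳` of all `x_{k+1}` with `k ∈ Ind_f`, `k > 0` and `x_1 ≤ x_{k+1} < x_q`. -/
def candidates (F : Set (List α)) (a : α) (q : ℕ) (x : ℕ → ℕ) (β : ℕ → List α) : Set ℕ :=
  {m | ∃ k ∈ indF F a q x β, 0 < k ∧ x 1 ≤ x (k + 1) ∧ x (k + 1) < x q ∧ m = x (k + 1)}

/-- `x* = max 𝒳` if `𝒳` is nonempty, and `x* = x_1 - 1` otherwise.  (`𝒳` is bounded by `x_q`,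
so that its supremum is its maximum.) -/
def xStar (F : Set (List α)) (a : α) (q : ℕ) (x : ℕ → ℕ) (β : ℕ → List α) : ℕ :=
  if (candidates F a q x β).Nonempty then sSup (candidates F a q x β) else x 1 - 1

/-- The level `ℓ(p_{q-1}) + x*`. -/
def threshold (F : Set (List α)) (a : α) (q : ℕ) (x : ℕ → ℕ) (β : ℕ → List α) : ℕ :=
  (pref a x β (q - 1)).length + xStar F a q x β

end Presentation

end CMR

end

open scoped Classical

namespace CMR

universe u v w

/-! ### Follower-separated presentations -/

namespace LabeledGraph

variable {α : Type u} {V : Type v} {W : Type w}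

/-! Write z for the second forbidden word, B_k for `blocks a x β k` and B for B_{q-1}. The follower
set of a state u consists of the w with uw in the system (`mem_cmr_followerSet`). As u is shorter
than n, uw fails only if w fails or w completes a suffix of u to a forbidden word
(`not_mem_ftcs_append_iff`). A level l with x₁ < l < n holds two states, a^l and the prefix of z of
length l; for l = |B| + t the latter is B a^t. Let t ≥ x₁. If w completes a suffix of a^l to a^n, it
begins with a^{x_q - t} and completes B a^t to z; if it completes one to z, that suffix is a^i with
i ≤ x₁, also a suffix of a^t. Conversely, a suffix of B a^t that is a prefix of z but no power of a
is B_k a^t with t ≤ x_{k+1}. If x_{k+1} ≥ x_q, its completion begins with a^{x_q - t} and so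
completes a^l to a^n. If x_{k+1} < x_q, then k lies in Ind_f and t ≤ x*. Hence the states agree for
t > x* (`append_mem_ftcs_iff`); below that, explicit completions of z separate them
(`exists_not_append_mem_ftcs_iff`). States at different levels never agree, so the merged graph has
distinct follower sets. A long block of a letter b ≠ a joins any two words of the system, so every
finite deterministic presentation has a state with full follower set; from there it realizes every
follower set of the merged graph, which gives minimality and uniqueness
(`isShannonCover_and_unique`). -/

theorem path_append (G : LabeledGraph α V) (u w : List α) (s t : V) :
    G.Path s (u ++ w) t ↔ ∃ m, G.Path s u m ∧ G.Path m w t := by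
  induction u generalizing s with
  | nil => simp [Path]
  | cons c u ih =>
    simp only [List.cons_append, Path, ih]
    constructor
    · rintro ⟨s', h, m, h1, h2⟩
      exact ⟨m, ⟨s', h, h1⟩, h2⟩
    · rintro ⟨m, ⟨s', h, h1⟩, h2⟩
      exact ⟨s', h, m, h1, h2⟩

theorem Deterministic.path_unique {G : LabeledGraph α V} (hG : G.Deterministic) {w : List α}
    {s t t' : V} (h : G.Path s w t) (h' : G.Path s w t') : t = t' := by
  induction w generalizing s with
  | nil => exact (show s = t from h).symm.trans h'
  | cons c w ih =>
    obtain ⟨m, h1, h2⟩ := h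
    obtain ⟨m', h1', h2'⟩ := h'
    obtain rfl := hG _ _ _ _ h1 h1'
    exact ih h2 h2'

theorem Deterministic.followerSet_of_path {G : LabeledGraph α V} (hG : G.Deterministic)
    {u : List α} {s t : V} (h : G.Path s u t) :
    G.followerSet t = {w | u ++ w ∈ G.followerSet s} := by
  ext w
  simp only [followerSet, Set.mem_ofPred_eq, path_append]
  constructor
  · rintro ⟨t', h'⟩
    exact ⟨t', t, h, h'⟩
  · rintro ⟨t', m, h1, h2⟩
    obtain rfl := hG.path_unique h h1
    exact ⟨t', h2⟩

theorem path_singleton (G : LabeledGraph α V) (c : α) (s t : V) :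
    G.Path s [c] t ↔ G.Edge s c t := by
  simp [Path]

theorem mem_followerSet_of_append {G : LabeledGraph α V} {u w : List α} {s : V}
    (h : u ++ w ∈ G.followerSet s) : u ∈ G.followerSet s := by
  obtain ⟨t, h⟩ := h
  obtain ⟨m, h, -⟩ := (G.path_append _ _ _ _).1 h
  exact ⟨m, h⟩

/-- If any two words of `S` can be joined by `σ` within `S`, then every finite deterministic
presentation of `S` has a state whose follower set is all of `S`. -/
theorem Deterministic.exists_followerSet_eq [Finite V] {G : LabeledGraph α V}
    (hG : G.Deterministic) {S : Set (List α)} (hS : G.system = S) (hnil : [] ∈ S)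
    (σ : List α) (hσ : ∀ u ∈ S, ∀ w ∈ S, u ++ σ ++ w ∈ S) :
    ∃ s, G.followerSet s = S := by
  by_contra! hne
  have hsub : ∀ s, G.followerSet s ⊆ S := fun s w hw => hS ▸ ⟨s, hw⟩
  have hex : ∀ s, ∃ w ∈ S, w ∉ G.followerSet s := fun s => by
    by_contra! h
    exact hne s (Set.Subset.antisymm (hsub s) h)
  -- Descent on the number of states from which w can be read. If w σ leads from s to t and t misses
  -- y, then w σ y is still in S but can no longer be read from s.
  have key : ∀ k : ℕ, ∀ w ∈ S, {s | w ∈ G.followerSet s}.ncard ≤ k → False := by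
    intro k
    induction k with
    | zero =>
      intro w hw hk
      have h0 := (Set.ncard_eq_zero (Set.toFinite _)).1 (Nat.le_zero.1 hk)
      rw [← hS] at hw
      obtain ⟨s, hs⟩ := hw
      exact Set.notMem_empty s (h0 ▸ hs)
    | succ k ih =>
      intro w hw hk
      have hws : w ++ σ ∈ S := by simpa using hσ w hw [] hnil
      have hws' := hws
      rw [← hS] at hws'
      obtain ⟨s, t, hst⟩ := hws'
      obtain ⟨y, hy, hyt⟩ := hex t
      refine ih (w ++ σ ++ y) (hσ w hw y hy) ?_
      have hlt : {s | w ++ σ ++ y ∈ G.followerSet s} ⊂ {s | w ∈ G.followerSet s} := by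
        refine ⟨fun r hr => ?_, fun h => ?_⟩
        · exact mem_followerSet_of_append (mem_followerSet_of_append hr)
        · have h1 : s ∈ {s | w ∈ G.followerSet s} := mem_followerSet_of_append ⟨t, hst⟩
          have h2 : w ++ σ ++ y ∈ G.followerSet s := h h1
          rw [hG.followerSet_of_path hst] at hyt
          exact hyt h2
      have := Set.ncard_lt_ncard hlt (Set.toFinite _)
      omega
  exact key _ [] hnil le_rfl

/-- The states of a follower-separated presentation embed into those of any other deterministic
presentation, preserving follower sets. -/
theorem exists_injective_followerSet [Finite W] {M : LabeledGraph α V} {H : LabeledGraph α W}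
    (hM : M.Deterministic) (hH : H.Deterministic) {S : Set (List α)} (s₀ : V)
    (hs₀ : M.followerSet s₀ = S) (hreach : ∀ s, ∃ w, M.Path s₀ w s)
    (hsep : ∀ s t, M.followerSet s = M.followerSet t → s = t)
    (σ : List α) (hσ : ∀ u ∈ S, ∀ w ∈ S, u ++ σ ++ w ∈ S) (hHS : H.system = S) :
    ∃ φ : V → W, Function.Injective φ ∧ ∀ s, H.followerSet (φ s) = M.followerSet s := by
  have hnil : [] ∈ S := hs₀ ▸ ⟨s₀, rfl⟩
  obtain ⟨h₀, hh₀⟩ := hH.exists_followerSet_eq hHS hnil σ hσ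
  have hφ : ∀ s, ∃ h, H.followerSet h = M.followerSet s := fun s => by
    obtain ⟨w, hw⟩ := hreach s
    have : w ∈ H.followerSet h₀ := by rw [hh₀, ← hs₀]; exact ⟨s, hw⟩
    obtain ⟨h, hh⟩ := this
    exact ⟨h, by rw [hH.followerSet_of_path hh, hM.followerSet_of_path hw, hh₀, hs₀]⟩
  choose φ hφ using hφ
  exact ⟨φ, fun s t hst => hsep s t (by rw [← hφ, ← hφ, hst]), hφ⟩

/-- When follower sets separate states, they determine the edges; a bijection of states preserving
follower sets is therefore an isomorphism. -/
theorem Deterministic.edge_iff {G : LabeledGraph α V} (hG : G.Deterministic)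
    (hsep : ∀ s t, G.followerSet s = G.followerSet t → s = t) (s : V) (c : α) (t : V) :
    G.Edge s c t ↔ [c] ∈ G.followerSet s ∧ G.followerSet t = {w | c :: w ∈ G.followerSet s} := by
  constructor
  · intro h
    have h' := (G.path_singleton c s t).2 h
    exact ⟨⟨t, h'⟩, hG.followerSet_of_path h'⟩
  · rintro ⟨⟨t', h'⟩, ht⟩
    obtain rfl : t' = t := hsep _ _ (by rw [ht, hG.followerSet_of_path h']; rfl)
    exact (G.path_singleton c s t').1 h'

/-- Transport of a labeled graph along a bijection of state sets. -/
def transport (G : LabeledGraph α V) (e : V ≃ W) : LabeledGraph α W where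
  Edge s c t := G.Edge (e.symm s) c (e.symm t)

theorem transport_path (G : LabeledGraph α V) (e : V ≃ W) (w : List α) (s t : W) :
    (G.transport e).Path s w t ↔ G.Path (e.symm s) w (e.symm t) := by
  induction w generalizing s with
  | nil => simp [Path]
  | cons c w ih =>
    simp only [Path, ih]
    constructor
    · rintro ⟨s', h, h'⟩
      exact ⟨_, h, h'⟩
    · rintro ⟨s', h, h'⟩
      exact ⟨e s', by simpa [transport] using h, by simpa using h'⟩

theorem transport_deterministic {G : LabeledGraph α V} (hG : G.Deterministic) (e : V ≃ W) :
    (G.transport e).Deterministic := fun _ _ _ _ h h' => e.symm.injective (hG _ _ _ _ h h')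

theorem transport_system (G : LabeledGraph α V) (e : V ≃ W) :
    (G.transport e).system = G.system := by
  ext w
  simp only [system, followerSet, Set.mem_ofPred_eq, transport_path]
  constructor
  · rintro ⟨s, t, h⟩
    exact ⟨_, _, h⟩
  · rintro ⟨s, t, h⟩
    exact ⟨e s, e t, by simpa using h⟩

/-- A finite deterministic graph with distinct follower sets, all of whose states are reachable
from a state with follower set `S`, is the unique Shannon cover of `S`, provided any two words of
`S` can be joined by `σ` within `S`. -/
theorem isShannonCover_and_unique [Finite V] {M : LabeledGraph α V}
    (hM : M.Deterministic) {S : Set (List α)} (hMS : M.system = S) (s₀ : V)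
    (hs₀ : M.followerSet s₀ = S) (hreach : ∀ s, ∃ w, M.Path s₀ w s)
    (hsep : ∀ s t, M.followerSet s = M.followerSet t → s = t)
    (σ : List α) (hσ : ∀ u ∈ S, ∀ w ∈ S, u ++ σ ++ w ∈ S) :
    M.IsShannonCover S ∧
      ∀ (W : Type) (H : LabeledGraph α W), H.IsShannonCover S → H.Isomorphic M := by
  refine ⟨⟨inferInstance, hM, hMS, ?_⟩, ?_⟩
  · intro W _ H hH hHS
    obtain ⟨φ, hφ, -⟩ := exists_injective_followerSet hM hH s₀ hs₀ hreach hsep σ hσ hHS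
    exact Nat.card_le_card_of_injective φ hφ
  · rintro W H ⟨hfin, hH, hHS, hmin⟩
    obtain ⟨φ, hφ, hF⟩ := exists_injective_followerSet hM hH s₀ hs₀ hreach hsep σ hσ hHS
    have hle : Nat.card W ≤ Nat.card V := by
      -- Minimality of H quantifies over state sets in `Type`, so M is first copied onto `Fin`.
      have := hmin (Fin (Nat.card V)) (M.transport (Finite.equivFin V))
        (transport_deterministic hM _) ((M.transport_system _).trans hMS)
      simpa using this
    have hbij : Function.Bijective φ :=
      hφ.bijective_of_nat_card_le hle
    have hsepH : ∀ s t, H.followerSet s = H.followerSet t → s = t := by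
      intro s t h
      obtain ⟨s, rfl⟩ := hbij.2 s
      obtain ⟨t, rfl⟩ := hbij.2 t
      rw [hF, hF] at h
      rw [hsep _ _ h]
    let e := Equiv.ofBijective φ hbij
    have he : ∀ s, M.followerSet (e.symm s) = H.followerSet s := fun s => by
      rw [← hF]
      exact congrArg _ (e.apply_symm_apply s)
    refine ⟨e.symm, fun s c t => ?_⟩
    rw [hH.edge_iff hsepH, hM.edge_iff hsep, he, he]

/-! ### Merging equivalent states -/

theorem merge_deterministic {G : LabeledGraph α V} (hG : G.Deterministic) (r : V → V) :
    (G.merge r).Deterministic := by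
  rintro s c t t' ⟨m, h, hm⟩ ⟨m', h', hm'⟩
  obtain rfl := hG _ _ _ _ h h'
  exact Subtype.ext (hm.symm.trans hm')

theorem merge_followerSet {G : LabeledGraph α V} {r : V → V}
    (hr : ∀ s, G.followerSet (r s) = G.followerSet s) (hrr : ∀ s, r (r s) = r s)
    (s : {s : V // r s = s}) : (G.merge r).followerSet s = G.followerSet s.1 := by
  ext w
  induction w generalizing s with
  | nil => exact ⟨fun _ => ⟨s.1, rfl⟩, fun _ => ⟨s, rfl⟩⟩
  | cons c w ih =>
    constructor
    · rintro ⟨t, s', ⟨m, hm, hms⟩, h⟩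
      have h1 := (ih s').1 ⟨t, h⟩
      rw [← hms, hr] at h1
      obtain ⟨t', ht'⟩ := h1
      exact ⟨t', m, hm, ht'⟩
    · rintro ⟨t, m, hm, h⟩
      have h1 : w ∈ G.followerSet (r m) := by rw [hr]; exact ⟨t, h⟩
      obtain ⟨t', ht'⟩ := (ih ⟨r m, hrr m⟩).2 h1
      exact ⟨t', ⟨r m, hrr m⟩, ⟨m, hm, rfl⟩, ht'⟩

end LabeledGraph

end CMR

namespace CMR

universe u

variable {α : Type u}

/-! ### The longest suffix that is a state -/

/-- `v` is the longest suffix of `u` that is a prefix of a word of `F`. -/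
def IsLongestState (F : Set (List α)) (u v : List α) : Prop :=
  IsState F v ∧ v <:+ u ∧ ∀ y, IsState F y → y <:+ u → y <:+ v

theorem isState_nil {F : Set (List α)} (hF : F.Nonempty) : IsState F [] :=
  let ⟨x, hx⟩ := hF
  ⟨x, hx, List.nil_prefix⟩

theorem IsState.of_prefix {F : Set (List α)} {u v : List α} (hv : IsState F v) (h : u <+: v) :
    IsState F u :=
  let ⟨x, hx, hvx⟩ := hv
  ⟨x, hx, h.trans hvx⟩

theorem find_tails_spec (p : List α → Bool) (hp : p [] = true) (u : List α) :
    ∃ v, u.tails.find? p = some v ∧ p v = true ∧ v <:+ u ∧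
      ∀ y, p y = true → y <:+ u → y <:+ v := by
  induction u with
  | nil => exact ⟨[], by simp [hp], hp, List.suffix_rfl, fun y _ h => h⟩
  | cons c u ih =>
    by_cases h : p (c :: u) = true
    · exact ⟨c :: u, by simp [h], h, List.suffix_rfl, fun y _ h => h⟩
    · obtain ⟨v, h1, h2, h3, h4⟩ := ih
      refine ⟨v, by simp [h, h1], h2, h3.trans (List.suffix_cons c u), fun y hy hyu => ?_⟩
      rcases List.suffix_cons_iff.1 hyu with rfl | h'
      · exact absurd hy h
      · exact h4 y hy h'

theorem transition_spec {F : Set (List α)} (hF : F.Nonempty) (u : List α) (c : α) :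
    IsLongestState F (u ++ [c]) (transition F u c) := by
  obtain ⟨v, h1, h2, h3, h4⟩ :=
    find_tails_spec (fun v => decide (IsState F v)) (by simpa using isState_nil hF) (u ++ [c])
  have : transition F u c = v := by rw [transition, h1, Option.getD_some]
  rw [this]
  exact ⟨by simpa using h2, h3, fun y hy => h4 y (by simpa using hy)⟩

theorem transition_eq_of_isState {F : Set (List α)} (hF : F.Nonempty) {u : List α} {c : α}
    (h : IsState F (u ++ [c])) : transition F u c = u ++ [c] := by
  obtain ⟨-, h2, h3⟩ := transition_spec hF u c
  exact h2.eq_of_length_le (h3 _ h List.suffix_rfl).length_le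

theorem suffix_concat_cases {y u : List α} {c : α} (h : y <:+ u ++ [c]) :
    y = [] ∨ ∃ y', y = y' ++ [c] ∧ y' <:+ u := by
  rcases List.eq_nil_or_concat y with rfl | ⟨y', d, rfl⟩
  · exact Or.inl rfl
  · right
    obtain ⟨t, ht⟩ := h
    rw [List.concat_eq_append, ← List.append_assoc] at ht
    obtain ⟨h1, h2⟩ := List.append_inj' ht rfl
    exact ⟨y', by simpa using h2, t, h1⟩

/-- States are closed under prefixes: a nonempty state that is a suffix of uc is y'c with y' a state
and a suffix of u, hence a suffix of v. Nothing is lost by remembering v alone. -/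
theorem IsLongestState.transition {F : Set (List α)} (hF : F.Nonempty) {u v : List α}
    (h : IsLongestState F u v) (c : α) :
    IsLongestState F (u ++ [c]) (transition F v c) := by
  obtain ⟨h1, h2, h3⟩ := transition_spec hF v c
  obtain ⟨k1, k2, k3⟩ := h
  have hs : ∀ {y' u' : List α}, y' <:+ u' → y' ++ [c] <:+ u' ++ [c] := by
    rintro y' _ ⟨t, rfl⟩
    exact ⟨t, by simp⟩
  refine ⟨h1, h2.trans (hs k2), fun y hy hyu => ?_⟩
  rcases suffix_concat_cases hyu with rfl | ⟨y', rfl, hy'⟩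
  · exact List.nil_suffix
  · exact h3 _ hy (hs (k3 _ (hy.of_prefix (List.prefix_append _ _)) hy'))

/-! ### Iterates of the failure function -/

/-- Since `failureFn` drops the first letter before this fold, its value at a nonempty word is the
longest proper suffix that is a state. -/
theorem isLongestState_foldl {F : Set (List α)} (hF : F.Nonempty) (u : List α) :
    IsLongestState F u (u.foldl (transition F) []) := by
  induction u using List.reverseRecOn with
  | nil => exact ⟨isState_nil hF, List.suffix_rfl, fun y _ h => h⟩
  | append_singleton u c ih => simpa using ih.transition hF c

theorem failureFn_suffix {F : Set (List α)} (hF : F.Nonempty) (u : List α) :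
    failureFn F u <:+ u := by
  cases u with
  | nil => exact List.suffix_rfl
  | cons c u => exact (isLongestState_foldl hF u).2.1.trans (List.suffix_cons c u)

theorem failureFn_length_lt {F : Set (List α)} (hF : F.Nonempty) {u : List α} (hu : u ≠ []) :
    (failureFn F u).length < u.length := by
  cases u with
  | nil => exact absurd rfl hu
  | cons c u =>
    have := (isLongestState_foldl hF u).2.1.length_le
    simp only [failureFn, List.length_cons]
    omega

theorem iterate_failureFn_suffix {F : Set (List α)} (hF : F.Nonempty) (r : ℕ) (u : List α) :
    (failureFn F)^[r] u <:+ u := by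
  induction r generalizing u with
  | zero => exact List.suffix_rfl
  | succ r ih => exact (ih _).trans (failureFn_suffix hF u)

/-- The iterates of the failure function at a nonempty word `u` are the proper suffixes of `u`
that are states. -/
theorem exists_iterate_failureFn_iff {F : Set (List α)} (hF : F.Nonempty) {u v : List α}
    (hu : u ≠ []) (hv : IsState F v) :
    (∃ r, 1 ≤ r ∧ (failureFn F)^[r] u = v) ↔ v <:+ u ∧ v.length < u.length := by
  constructor
  · rintro ⟨r, hr, rfl⟩
    obtain ⟨r, rfl⟩ := Nat.exists_eq_add_of_le' hr
    refine ⟨iterate_failureFn_suffix hF _ _, ?_⟩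
    exact (iterate_failureFn_suffix hF r (failureFn F u)).length_le.trans_lt
      (failureFn_length_lt hF hu)
  · rintro ⟨hs, hlt⟩
    induction hn : u.length using Nat.strong_induction_on generalizing u with
    | _ n ih =>
      have hvf : v <:+ failureFn F u := by
        cases u with
        | nil => exact absurd rfl hu
        | cons c u =>
          rcases List.suffix_cons_iff.1 hs with rfl | h
          · exact absurd hlt (lt_irrefl _)
          · exact (isLongestState_foldl hF u).2.2 v hv h
      rcases hvf.length_le.lt_or_eq with h | h
      · have hne : failureFn F u ≠ [] := fun h0 => by simp [h0] at h
        obtain ⟨r, -, hr⟩ := ih _ (hn ▸ failureFn_length_lt hF hu) hne hvf h rfl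
        exact ⟨r + 1, by omega, hr⟩
      · exact ⟨1, le_rfl, (hvf.eq_of_length h).symm⟩

/-! ### Follower sets of the CMR presentation -/

theorem ftcs_of_infix {F : Set (List α)} {u v : List α} (hv : v ∈ ftcs F) (h : u <:+: v) :
    u ∈ ftcs F := fun x hx hxu => hv x hx (hxu.trans h)

theorem infix_append_cases {x u w : List α} (h : x <:+: u ++ w) :
    x <:+: u ∨ x <:+: w ∨ ∃ p r, x = p ++ r ∧ p ≠ [] ∧ r ≠ [] ∧ p <:+ u ∧ r <+: w := by
  obtain ⟨s, t, h⟩ := h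
  rw [List.append_assoc] at h
  rcases List.append_eq_append_iff.1 h with ⟨u', rfl, h'⟩ | ⟨w', rfl, h'⟩
  · rcases List.append_eq_append_iff.1 h' with ⟨t', rfl, h''⟩ | ⟨r, rfl, h''⟩
    · exact Or.inl ⟨s, t', by simp⟩
    · by_cases hu : u' = []
      · subst hu
        exact Or.inr (Or.inl ⟨[], t, by simp [h'']⟩)
      by_cases hr : r = []
      · subst hr
        exact Or.inl ⟨s, [], by simp⟩
      exact Or.inr (Or.inr ⟨u', r, rfl, hu, hr, ⟨s, rfl⟩, ⟨t, h''.symm⟩⟩)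
  · exact Or.inr (Or.inl ⟨w', t, by simp [h']⟩)

theorem append_infix_of_suffix_prefix {p r u w : List α} (hp : p <:+ u) (hr : r <+: w) :
    p ++ r <:+: u ++ w := by
  obtain ⟨s, rfl⟩ := hp
  obtain ⟨t, rfl⟩ := hr
  exact ⟨s, t, by simp⟩

theorem cmr_deterministic (F : Set (List α)) : (cmr F).Deterministic :=
  fun _ _ _ _ h h' => Subtype.ext (h.trans h'.symm)

theorem length_lt_of_isState {F : Set (List α)} {n : ℕ} (hn : ∀ x ∈ F, x.length = n)
    {u : List α} (hu : IsState F u) (hu' : u ∉ F) : u.length < n := by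
  obtain ⟨x, hx, hux⟩ := hu
  rcases hux.length_le.lt_or_eq with h | h
  · exact h.trans_eq (hn x hx)
  · exact absurd (hux.eq_of_length h ▸ hx) hu'

/-- The automaton forgets only what no forbidden word can use: if a forbidden word straddles uc and
w, its part inside uc is a state, hence a suffix of δ(u, c). Equal lengths ensure that a forbidden
word inside uc is uc itself. -/
theorem mem_cmr_followerSet {F : Set (List α)} (hF : F.Nonempty) {n : ℕ}
    (hn : ∀ x ∈ F, x.length = n) (u : State F) (w : List α) :
    w ∈ (cmr F).followerSet u ↔ u.1 ++ w ∈ ftcs F := by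
  induction w generalizing u with
  | nil =>
    refine ⟨fun _ x hx hxu => ?_, fun _ => ⟨u, rfl⟩⟩
    have h1 := length_lt_of_isState hn u.2.1 u.2.2
    have h2 := hxu.length_le
    have h3 := hn x hx
    simp only [List.append_nil] at h2
    omega
  | cons c w ih =>
    obtain ⟨h1, h2, h3⟩ := transition_spec hF u.1 c
    have hu := length_lt_of_isState hn u.2.1 u.2.2
    have key : u.1 ++ c :: w ∈ ftcs F ↔
        transition F u.1 c ∉ F ∧ transition F u.1 c ++ w ∈ ftcs F := by
      rw [show u.1 ++ c :: w = (u.1 ++ [c]) ++ w by simp]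
      constructor
      · intro h
        refine ⟨fun hmem => h _ hmem (h2.isInfix.trans (List.infix_append' [] _ _)), ?_⟩
        refine ftcs_of_infix h ?_
        obtain ⟨s, hs⟩ := h2
        exact ⟨s, [], by rw [← hs]; simp⟩
      · rintro ⟨hnm, h⟩ x hx hxu
        have hxn := hn x hx
        rcases infix_append_cases hxu with h' | h' | ⟨p, r, rfl, -, -, hp, hr⟩
        · have hlen := h'.length_le
          have hxe : x = u.1 ++ [c] := h'.eq_of_length_le (by simp; omega)
          subst hxe
          have := transition_eq_of_isState hF (u := u.1) (c := c) ⟨_, hx, List.prefix_rfl⟩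
          exact hnm (this ▸ hx)
        · exact h x hx (h'.trans (List.suffix_append _ _).isInfix)
        · exact h _ hx (append_infix_of_suffix_prefix
            (h3 p ⟨_, hx, List.prefix_append _ _⟩ hp) hr)
    rw [key]
    constructor
    · rintro ⟨t, s', hs', ht⟩
      have hs : s'.1 = transition F u.1 c := hs'
      rw [← hs]
      exact ⟨s'.2.2, (ih s').1 ⟨t, ht⟩⟩
    · rintro ⟨hnm, h⟩
      obtain ⟨t, ht⟩ := (ih ⟨_, h1, hnm⟩).2 h
      exact ⟨t, ⟨_, h1, hnm⟩, rfl, ht⟩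

theorem not_mem_ftcs_append_iff {F : Set (List α)} {n : ℕ} (hn : ∀ x ∈ F, x.length = n)
    {u : List α} (hu : u.length < n) (w : List α) :
    u ++ w ∉ ftcs F ↔
      w ∉ ftcs F ∨ ∃ p r, p ++ r ∈ F ∧ p ≠ [] ∧ p <:+ u ∧ r <+: w := by
  constructor
  · intro h
    simp only [ftcs, Set.mem_ofPred_eq, not_forall, not_not] at h
    obtain ⟨x, hx, hxu⟩ := h
    rcases infix_append_cases hxu with h' | h' | ⟨p, r, rfl, h1, -, h2, h3⟩
    · have := h'.length_le
      have := hn x hx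
      omega
    · exact Or.inl fun h => h x hx h'
    · exact Or.inr ⟨p, r, hx, h1, h2, h3⟩
  · rintro (h | ⟨p, r, h, -, h2, h3⟩) h'
    · exact h (ftcs_of_infix h' (List.suffix_append _ _).isInfix)
    · exact h' _ h (append_infix_of_suffix_prefix h2 h3)

theorem cmr_path_isState {F : Set (List α)} (hF : F.Nonempty) (u : List α) (hu : IsState F u)
    (hu' : ∀ v, v <+: u → v ∉ F) :
    (cmr F).Path ⟨[], isState_nil hF, hu' [] List.nil_prefix⟩ u
      ⟨u, hu, hu' u List.prefix_rfl⟩ := by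
  induction u using List.reverseRecOn with
  | nil => rfl
  | append_singleton u c ih =>
    have hpre : u <+: u ++ [c] := List.prefix_append _ _
    rw [LabeledGraph.path_append]
    refine ⟨_, ih (hu.of_prefix hpre) fun v hv => hu' v (hv.trans hpre), ?_⟩
    rw [LabeledGraph.path_singleton]
    exact (transition_eq_of_isState hF hu).symm

theorem finite_state [Fintype α] {F : Set (List α)} {n : ℕ} (hn : ∀ x ∈ F, x.length = n) :
    Finite (State F) :=
  ((List.finite_length_le α n).subset (t := {u | IsState F u ∧ u ∉ F})
    fun _ hu => (length_lt_of_isState hn hu.1 hu.2).le).to_subtype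

end CMR

namespace CMR

universe u

variable {α : Type u}

/-! ### Occurrences of the forbidden words -/

theorem exists_index_of_infix {x u : List α} (h : x <:+: u) :
    ∃ s, s + x.length ≤ u.length ∧ ∀ i < x.length, u[s + i]? = x[i]? := by
  obtain ⟨s, t, rfl⟩ := h
  refine ⟨s.length, by simp, fun i hi => ?_⟩
  grind

theorem mem_ftcs_pair {x y w : List α} :
    w ∈ ftcs {x, y} ↔ ¬ x <:+: w ∧ ¬ y <:+: w := by
  simp [ftcs]

/-- The word has length n, so it only has to differ from both forbidden words: from a^n at index k,
from z at index m. -/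
theorem replicate_append_drop_mem_ftcs {a : α} {z : List α} {m k l : ℕ}
    (hzm : z[m]? ≠ some a) (hml : m < l)
    (hlk : l ≤ k) (hk : k < z.length) (hzk : z[k]? ≠ some a) :
    List.replicate l a ++ z.drop l ∈ ftcs {List.replicate z.length a, z} := by
  rw [mem_ftcs_pair]
  constructor
  · intro h
    have h' := h.eq_of_length_le (by simp; omega)
    apply hzk
    have : (List.replicate z.length a)[k]? = (List.replicate l a ++ z.drop l)[k]? := by rw [← h']
    grind
  · intro h
    have h' := h.eq_of_length_le (by simp; omega)
    apply hzm
    rw [h']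
    grind

/-- Here m is the length of the first run of z and b - 1 the position of its last letter other than
a. An occurrence of a^n would cover a letter other than a. An occurrence of z at s = 0 fails at l,
and one at 0 < s ≤ m fails at m. -/
theorem take_append_drop_mem_ftcs {a : α} {z : List α} {m b l : ℕ}
    (hz : ∀ i < m, z[i]? = some a) (hzm : z[m]? ≠ some a) (hmb : m < b)
    (hzb : z[b - 1]? ≠ some a) (htail : ∀ i, b ≤ i → i < z.length → z[i]? = some a)
    (hbl : b ≤ l) (hlm : l < b + m) (hl : l < z.length) :
    z.take l ++ z.drop m ∈ ftcs {List.replicate z.length a, z} := by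
  have hT : ∀ i, i < l → (z.take l ++ z.drop m)[i]? = z[i]? := fun i hi => by
    rw [List.getElem?_append_left (by simp; omega), List.getElem?_take_of_lt hi]
  have hT' : ∀ i, l ≤ i → (z.take l ++ z.drop m)[i]? = z[m + (i - l)]? := fun i hi => by
    rw [List.getElem?_append_right (by simp; omega), List.getElem?_drop, List.length_take,
      min_eq_left hl.le]
  have hlen : (z.take l ++ z.drop m).length = l + (z.length - m) := by simp; omega
  rw [mem_ftcs_pair]
  constructor
  · intro h
    obtain ⟨s, h1, h2⟩ := exists_index_of_infix h
    rw [hlen, List.length_replicate] at h1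
    rw [List.length_replicate] at h2
    rcases Nat.lt_or_ge (b - 1) s with hs | hs
    · have h3 := h2 (l - s) (by omega)
      rw [show s + (l - s) = l by omega, hT' l le_rfl] at h3
      apply hzm
      simp only [Nat.sub_self, Nat.add_zero] at h3
      rw [h3, List.getElem?_replicate, if_pos (by omega)]
    · have h3 := h2 (b - 1 - s) (by omega)
      rw [show s + (b - 1 - s) = b - 1 by omega, hT _ (by omega)] at h3
      apply hzb
      rw [h3, List.getElem?_replicate, if_pos (by omega)]
  · intro h
    obtain ⟨s, h1, h2⟩ := exists_index_of_infix h
    rw [hlen] at h1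
    rcases Nat.eq_zero_or_pos s with rfl | hs
    · have h3 := h2 l hl
      rw [Nat.zero_add, hT' l le_rfl, htail l hbl hl] at h3
      exact hzm (by simpa using h3)
    rcases Nat.lt_or_ge m s with hms | hms
    -- The last letter other than a of this occurrence falls in the part `z.drop m`, so it equals
    -- the letter of z at s + (m + b - 1 - l). That index lies in the overlap of the occurrence with
    -- `z.take l`, and there the occurrence is still in its opening run of a.
    · have h3 := h2 (b - 1) (by omega)
      rw [hT' _ (by omega), show m + (s + (b - 1) - l) = s + (m + b - 1 - l) by omega] at h3
      have h4 := h2 (m + b - 1 - l) (by omega)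
      rw [hT _ (by omega), hz (m + b - 1 - l) (by omega)] at h4
      exact hzb (h3.symm.trans h4)
    · have h3 := h2 (m - s) (by omega)
      rw [show s + (m - s) = m by omega, hT _ (by omega), hz (m - s) (by omega)] at h3
      exact hzm h3

/-- Every window of length n covers the letter `z[e]`, which excludes a^n. An occurrence of z would
put `z[m]` inside the leading run of a, because m < d. -/
theorem replicate_append_drop_mem_ftcs' {a : α} {z : List α} {m e d l : ℕ}
    (hm : m < z.length) (hzm : z[m]? ≠ some a) (hde : d ≤ e) (he : e < z.length)
    (hze : z[e]? ≠ some a) (hmd : m < d) (hel : l + e < z.length + d) :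
    List.replicate l a ++ z.drop d ∈ ftcs {List.replicate z.length a, z} := by
  have hT : ∀ i, i < l → (List.replicate l a ++ z.drop d)[i]? = some a := fun i hi => by grind
  have hT' : (List.replicate l a ++ z.drop d)[l + (e - d)]? = z[e]? := by grind
  have hlen : (List.replicate l a ++ z.drop d).length = l + (z.length - d) := by simp
  rw [mem_ftcs_pair]
  constructor
  · intro h
    obtain ⟨s, h1, h2⟩ := exists_index_of_infix h
    rw [hlen, List.length_replicate] at h1
    rw [List.length_replicate] at h2
    have h3 := h2 (l + (e - d) - s) (by omega)
    rw [show s + (l + (e - d) - s) = l + (e - d) by omega, hT'] at h3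
    apply hze
    rw [h3, List.getElem?_replicate, if_pos (by omega)]
  · intro h
    obtain ⟨s, h1, h2⟩ := exists_index_of_infix h
    rw [hlen] at h1
    have h3 := h2 m hm
    rw [hT _ (by omega)] at h3
    exact hzm h3.symm

/-! ### The parse -/

theorem prefix_append_cases {l u w : List α} (h : l <+: u ++ w) :
    l <+: u ∨ ∃ y, l = u ++ y ∧ y <+: w := by
  obtain ⟨t, ht⟩ := h
  rcases List.append_eq_append_iff.1 ht with ⟨t', rfl, -⟩ | ⟨y, rfl, h'⟩
  · exact Or.inl (List.prefix_append _ _)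
  · exact Or.inr ⟨y, rfl, t, h'.symm⟩

theorem blocks_succ (a : α) (x : ℕ → ℕ) (β : ℕ → List α) (j : ℕ) :
    blocks a x β (j + 1) = blocks a x β j ++ (List.replicate (x (j + 1)) a ++ β (j + 1)) := by
  simp [blocks, List.range_succ]

theorem blocks_prefix (a : α) (x : ℕ → ℕ) (β : ℕ → List α) {i j : ℕ} (h : i ≤ j) :
    blocks a x β i <+: blocks a x β j := by
  induction h with
  | refl => exact List.prefix_rfl
  | step _ ih => exact ih.trans (blocks_succ a x β _ ▸ List.prefix_append _ _)

/-- The word is nonempty and does not end in `a`. -/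
def EndsOff (a : α) (y : List α) : Prop :=
  ∃ y' d, y = y' ++ [d] ∧ d ≠ a

theorem EndsOff.ne_nil {a : α} {y : List α} (h : EndsOff a y) : y ≠ [] := by
  obtain ⟨y', d, rfl, -⟩ := h
  simp

theorem EndsOff.of_suffix {a : α} {y u : List α} (h : EndsOff a u) (hy : y ≠ []) (hyu : y <:+ u) :
    EndsOff a y := by
  obtain ⟨u', d, rfl, hd⟩ := h
  rcases suffix_concat_cases hyu with rfl | ⟨y', rfl, -⟩
  · exact absurd rfl hy
  · exact ⟨y', d, rfl, hd⟩

namespace IsParse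

variable {a : α} {z : List α} {q : ℕ} {x : ℕ → ℕ} {β : ℕ → List α}

theorem endsOff_blocks (h : IsParse a z q x β) {k : ℕ} (hk : 1 ≤ k) (hkq : k < q) :
    EndsOff a (blocks a x β k) := by
  obtain ⟨k, rfl⟩ := Nat.exists_eq_add_of_le' hk
  rw [blocks_succ]
  rcases List.eq_nil_or_concat (β (k + 1)) with h0 | ⟨y, d, hd⟩
  · exact absurd h0 (h.ne_nil _ hk hkq)
  · refine ⟨blocks a x β k ++ (List.replicate (x (k + 1)) a ++ y), d, by simp [hd], ?_⟩
    rintro rfl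
    exact h.notMem _ hk hkq (by simp [hd])

/-- The run of `a`s that follows `blocks k`, for `k < q - 1`, is followed by another letter. -/
theorem exists_eq_append (h : IsParse a z q x β) {k : ℕ} (hkq : k + 1 < q) :
    ∃ e r, e ≠ a ∧ z = blocks a x β k ++ (List.replicate (x (k + 1)) a ++ e :: r) := by
  cases hβ : β (k + 1) with
  | nil => exact absurd hβ (h.ne_nil _ (by omega) hkq)
  | cons e β' =>
    obtain ⟨t, ht⟩ := blocks_prefix a x β (show k + 1 ≤ q - 1 by omega)
    refine ⟨e, β' ++ t ++ List.replicate (x q) a, ?_, ?_⟩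
    · rintro rfl
      exact h.notMem _ (by omega) hkq (by simp [hβ])
    · rw [h.eq, ← ht, blocks_succ, hβ]
      simp

/-- A letter other than a is followed by a only at the end of some β. The final run has arbitrary
length N so that removing the last β leaves the same shape, with N = x_{j+1}. -/
theorem eq_blocks_of_prefix (h : IsParse a z q x β) {j N : ℕ} (hj : j < q) {y : List α}
    (hy : EndsOff a y) (hyz : y ++ [a] <+: blocks a x β j ++ List.replicate N a) :
    ∃ k, 1 ≤ k ∧ k ≤ j ∧ y = blocks a x β k := by
  induction j generalizing N with
  | zero =>
    obtain ⟨y', d, rfl, hd⟩ := hy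
    have : d ∈ List.replicate N a := by
      have := hyz.subset (show d ∈ y' ++ [d] ++ [a] by simp)
      simpa [blocks] using this
    exact absurd (List.eq_of_mem_replicate this) hd
  | succ j ih =>
    rw [blocks_succ, ← List.append_assoc, List.append_assoc] at hyz
    rcases prefix_append_cases hyz with h' | ⟨y', hy', h'⟩
    · obtain ⟨k, h1, h2, h3⟩ := ih (by omega) h'
      exact ⟨k, h1, by omega, h3⟩
    · rcases List.eq_nil_or_concat y' with rfl | ⟨y'', c, rfl⟩
      · obtain ⟨k, h1, h2, h3⟩ := ih (N := x (j + 1)) (by omega) (by rw [hy']; simp)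
        exact ⟨k, h1, by omega, h3⟩
      rw [List.concat_eq_append] at h' hy'
      rw [← List.append_assoc] at hy'
      obtain ⟨h1, h2⟩ := List.append_inj' hy' rfl
      obtain rfl : a = c := by simpa using h2
      rcases prefix_append_cases h' with h3 | ⟨t, ht, h3⟩
      · exact absurd (h3.subset (by simp)) (h.notMem (j + 1) (by omega) hj)
      · refine ⟨j + 1, by omega, le_rfl, ?_⟩
        rw [blocks_succ, h1]
        obtain ⟨y0, d, rfl, hd⟩ := hy
        have ht' := (List.prefix_replicate_iff.1 h3).2
        rcases List.eq_nil_or_concat t with rfl | ⟨t', c, rfl⟩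
        · exfalso
          exact h.notMem (j + 1) (by omega) hj (by rw [← List.append_nil (β (j+1)), ← ht]; simp)
        rw [List.concat_eq_append, ← List.append_assoc] at ht
        obtain ⟨h4, -⟩ := List.append_inj' ht rfl
        rcases List.eq_nil_or_concat t' with rfl | ⟨t'', c', rfl⟩
        · rw [h4]
          simp
        · exfalso
          rw [h4] at h1
          have hc : d = c' := by
            have h5 := congrArg List.getLast? h1
            simpa [List.getLast?_append] using h5
          have : c' ∈ (t''.concat c').concat c := by simp
          rw [ht'] at this
          exact hd (hc.trans (List.eq_of_mem_replicate this))

end IsParse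

end CMR

/-! ### Letters of z by position, and comparison of the two states at a level -/

namespace CMR

universe u

variable {α : Type u}

namespace IsParse

variable {a : α} {z : List α} {q : ℕ} {x : ℕ → ℕ} {β : ℕ → List α}

theorem length_eq (h : IsParse a z q x β) :
    z.length = (blocks a x β (q - 1)).length + x q := by
  simpa using congrArg List.length h.eq

theorem getElem?_of_lt (h : IsParse a z q x β) {i : ℕ} (hi : i < x 1) : z[i]? = some a := by
  obtain ⟨e, r, -, hz⟩ := h.exists_eq_append (k := 0) (by have := h.two_le; omega)
  rw [hz]
  simp [blocks, List.getElem?_append, hi]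

theorem getElem?_ne {k : ℕ} (h : IsParse a z q x β) (hkq : k + 1 < q) :
    z[(blocks a x β k).length + x (k + 1)]? ≠ some a := by
  obtain ⟨e, r, he, hz⟩ := h.exists_eq_append hkq
  rw [hz, ← List.append_assoc, List.getElem?_append_right (by simp)]
  simpa using he

theorem getElem?_first_ne (h : IsParse a z q x β) : z[x 1]? ≠ some a := by
  simpa [blocks] using h.getElem?_ne (k := 0) (by have := h.two_le; omega)

theorem lt_length_blocks {k : ℕ} (h : IsParse a z q x β) (hk : 1 ≤ k) (hkq : k < q) :
    x 1 < (blocks a x β k).length := by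
  have h1 := (blocks_prefix a x β hk).length_le
  have h2 := List.length_pos_of_ne_nil (h.ne_nil 1 le_rfl (by omega))
  have h3 : (blocks a x β 1).length = x 1 + (β 1).length := by simp [blocks]
  omega

theorem getElem?_last_ne (h : IsParse a z q x β) :
    z[(blocks a x β (q - 1)).length - 1]? ≠ some a := by
  have := h.two_le
  obtain ⟨y, d, hy, hd⟩ := h.endsOff_blocks (k := q - 1) (by omega) (by omega)
  rw [h.eq, hy]
  simpa using hd

theorem getElem?_tail (h : IsParse a z q x β) {i : ℕ} (hi : (blocks a x β (q - 1)).length ≤ i)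
    (hi' : i < z.length) : z[i]? = some a := by
  have := h.length_eq
  rw [h.eq, List.getElem?_append_right hi, List.getElem?_replicate, if_pos (by omega)]

theorem take_eq (h : IsParse a z q x β) {t : ℕ} (ht : t ≤ x q) :
    z.take ((blocks a x β (q - 1)).length + t) =
      blocks a x β (q - 1) ++ List.replicate t a := by
  conv_lhs => rw [h.eq]
  rw [List.take_length_add_append, List.take_replicate, min_eq_left ht]

theorem replicate_prefix_iff (h : IsParse a z q x β) (i : ℕ) :
    List.replicate i a <+: z ↔ i ≤ x 1 := by
  constructor
  · rintro ⟨t, ht⟩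
    by_contra! hi
    apply h.getElem?_first_ne
    rw [← ht, List.getElem?_append_left (by simpa using hi), List.getElem?_replicate, if_pos hi]
  · intro hi
    obtain ⟨e, r, -, hz⟩ := h.exists_eq_append (k := 0) (by have := h.two_le; omega)
    obtain ⟨j, hj⟩ := Nat.exists_eq_add_of_le hi
    rw [hz]
    simp only [blocks, List.range_zero, List.flatMap_nil, List.nil_append, Nat.zero_add, hj,
      List.replicate_add, List.append_assoc]
    exact List.prefix_append _ _

/-- A prefix `y a^t` of `z`, with `t > 0` and `y` not ending in `a`, ends inside a run of `a`s. -/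
theorem exists_blocks_of_prefix (h : IsParse a z q x β) {y : List α} (hy : EndsOff a y) {t : ℕ}
    (ht : 0 < t) (hyz : y ++ List.replicate t a <+: z) :
    ∃ k, 1 ≤ k ∧ k < q ∧ y = blocks a x β k ∧ t ≤ x (k + 1) := by
  have hq := h.two_le
  obtain ⟨t, rfl⟩ := Nat.exists_eq_add_of_le' ht
  have h1 : y ++ [a] <+: z := by
    refine List.IsPrefix.trans ?_ hyz
    exact ⟨List.replicate t a, by simp [List.replicate_succ]⟩
  rw [h.eq] at h1
  obtain ⟨k, hk1, hkq, rfl⟩ := h.eq_blocks_of_prefix (by omega) hy h1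
  refine ⟨k, hk1, by omega, rfl, ?_⟩
  by_contra! hlt
  rcases Nat.lt_or_ge (k + 1) q with hk | hk
  · apply h.getElem?_ne hk
    obtain ⟨r, hr⟩ := hyz
    rw [← hr, List.append_assoc, List.getElem?_append_right (by simp),
      List.getElem?_append_left (by simpa using hlt), List.getElem?_replicate,
      if_pos (by omega)]
  · obtain rfl : k = q - 1 := by omega
    have := hyz.length_le
    rw [Nat.sub_add_cancel (by omega)] at hlt
    simp only [List.length_append, List.length_replicate, h.length_eq] at this
    omega

theorem isState_pref (h : IsParse a z q x β) (hxq : 0 < x q) {F : Set (List α)} (hz : z ∈ F)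
    {k : ℕ} (hk : k < q) : IsState F (pref a x β k) := by
  refine ⟨z, hz, ?_⟩
  rcases Nat.lt_or_ge (k + 1) q with hk' | hk'
  · obtain ⟨e, r, -, hz⟩ := h.exists_eq_append hk'
    obtain ⟨j, hj⟩ := Nat.exists_eq_add_of_le' (h.pos (k + 1) (by omega) hk')
    exact ⟨List.replicate j a ++ e :: r, by rw [hz, pref, hj]; simp [List.replicate_succ]⟩
  · obtain rfl : k = q - 1 := by omega
    obtain ⟨j, hj⟩ := Nat.exists_eq_add_of_le' hxq
    exact ⟨List.replicate j a, by rw [h.eq, pref, hj]; simp [List.replicate_succ]⟩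

/-- Iterates of the failure function run through the proper suffixes that are states, and the common
final a of the two distinguished prefixes cancels. Positivity of x_q makes p_{q-1} a state. -/
theorem mem_indF_iff (h : IsParse a z q x β) (hxq : 0 < x q) {F : Set (List α)} (hz : z ∈ F)
    {k : ℕ} : k ∈ indF F a q x β ↔ k < q ∧ blocks a x β k <:+ blocks a x β (q - 1) ∧
      (blocks a x β k).length < (blocks a x β (q - 1)).length := by
  simp only [indF, Set.mem_ofPred_eq]
  refine and_congr_right fun hk => ?_
  rw [exists_iterate_failureFn_iff ⟨z, hz⟩ (by simp [pref]) (h.isState_pref hxq hz hk)]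
  refine and_congr ⟨fun hs => ?_, ?_⟩ (by simp [pref])
  · rcases suffix_concat_cases hs with h0 | ⟨y, hy, hs'⟩
    · simp [pref] at h0
    · rwa [List.append_cancel_right (as := blocks a x β k) (bs := [a]) (cs := y) hy]
  · rintro ⟨t, ht⟩
    exact ⟨t, by rw [pref, pref, ← ht]; simp⟩

theorem bddAbove_candidates (F : Set (List α)) : BddAbove (candidates F a q x β) :=
  ⟨x q, by rintro _ ⟨k, -, -, -, hk, rfl⟩; exact hk.le⟩

/-- From level `ℓ(p_{q-1}) + x*` on, the two states at a level have the same continuations. -/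
theorem append_mem_ftcs_iff (h : IsParse a z q x β) {F : Set (List α)}
    (hF : F = {List.replicate z.length a, z}) {l : ℕ} (hl : threshold F a q x β ≤ l)
    (hlz : l < z.length) (w : List α) :
    List.replicate l a ++ w ∈ ftcs F ↔ z.take l ++ w ∈ ftcs F := by
  have hq := h.two_le
  have hx1 := h.pos 1 le_rfl (by omega)
  have hzF : z ∈ F := by simp [hF]
  have hnF : List.replicate z.length a ∈ F := by simp [hF]
  have hn : ∀ y ∈ F, y.length = z.length := by
    rintro y hy
    rw [hF] at hy
    rcases hy with rfl | rfl <;> simp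
  have hlen := h.length_eq
  obtain ⟨t, rfl⟩ : ∃ t, l = (blocks a x β (q - 1)).length + t :=
    Nat.exists_eq_add_of_le (by simp [threshold, pref] at hl; omega)
  -- Strict, because the final a of p_{q-1} counts towards the threshold.
  have ht : xStar F a q x β < t := by simp [threshold, pref] at hl; omega
  have hmax : ∀ m ∈ candidates F a q x β, m < t := fun m hm =>
    (le_csSup (bddAbove_candidates F) hm).trans_lt (by rwa [xStar, if_pos ⟨m, hm⟩] at ht)
  have hxt : x 1 ≤ t := by
    by_cases hne : (candidates F a q x β).Nonempty
    · obtain ⟨m, hm⟩ := hne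
      have := hmax m hm
      obtain ⟨k, -, -, h1, -, rfl⟩ := hm
      omega
    · rw [xStar, if_neg hne] at ht
      omega
  rw [← not_iff_not, not_mem_ftcs_append_iff hn (by simpa using hlz),
    not_mem_ftcs_append_iff hn (by simpa using hlz)]
  by_cases hw : w ∈ ftcs F
  swap
  · simp [hw]
  simp only [hw, not_true_eq_false, false_or]
  rw [h.take_eq (by omega)]
  -- Since |B| + x_q = n, these letters complete a^l to a^n.
  have hfull : List.replicate (x q - t) a <+: w →
      ∃ p r, p ++ r ∈ F ∧ p ≠ [] ∧
        p <:+ List.replicate ((blocks a x β (q - 1)).length + t) a ∧ r <+: w := by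
    intro hr
    refine ⟨List.replicate ((blocks a x β (q - 1)).length + t) a, _, ?_, ?_, List.suffix_rfl, hr⟩
    · rw [← List.replicate_add, show (blocks a x β (q - 1)).length + t + (x q - t) = z.length by
        omega]
      exact hnF
    · simp only [ne_eq, List.replicate_eq_nil_iff]
      omega
  constructor
  · rintro ⟨p, r, hpr, hp, hps, hr⟩
    obtain ⟨hi, hpi⟩ := List.suffix_replicate_iff.1 hps
    rw [hF] at hpr
    rcases hpr with hpr | hpr
    · refine ⟨blocks a x β (q - 1) ++ List.replicate t a, List.replicate (x q - t) a, ?_, ?_,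
        List.suffix_rfl, ?_⟩
      · rw [List.append_assoc, ← List.replicate_add, Nat.add_sub_cancel' (by omega), ← h.eq]
        exact hzF
      · have : t ≠ 0 := by omega
        simp [this]
      · refine List.IsPrefix.trans ?_ hr
        have hrlen : p.length + r.length = z.length := by
          simpa using congrArg List.length hpr
        have hr' : r = List.replicate r.length a := by
          refine List.eq_replicate_iff.2 ⟨rfl, fun b hb => ?_⟩
          exact List.eq_of_mem_replicate (hpr ▸ List.mem_append_right p hb)
        rw [hr', List.prefix_replicate_iff]
        simp
        omega
    · obtain rfl : p ++ r = z := hpr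
      have hpx : p.length ≤ x 1 := by
        rw [← h.replicate_prefix_iff, ← hpi]
        exact List.prefix_append _ _
      refine ⟨p, r, hzF, hp, ?_, hr⟩
      refine List.IsSuffix.trans ?_ (List.suffix_append _ _)
      rw [hpi, List.suffix_replicate_iff]
      simp
      omega
  · rintro ⟨p, r, hpr, hp, hps, hr⟩
    by_cases hpa : p = List.replicate p.length a
    · refine ⟨p, r, hpr, hp, ?_, hr⟩
      have := hps.length_le
      rw [List.suffix_replicate_iff]
      exact ⟨by simpa using this, hpa⟩
    rw [hF] at hpr
    rcases hpr with hpr | hpr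
    · exfalso
      apply hpa
      refine List.eq_replicate_iff.2 ⟨rfl, fun b hb => ?_⟩
      exact List.eq_of_mem_replicate (hpr ▸ List.mem_append_left r hb)
    -- A suffix of B a^t that is not a power of a must reach into B.
    obtain ⟨y, rfl, hyB⟩ : ∃ y, p = y ++ List.replicate t a ∧ y <:+ blocks a x β (q - 1) := by
      obtain ⟨s, hs⟩ := hps
      rcases List.append_eq_append_iff.1 hs with ⟨y, h1, rfl⟩ | ⟨y, rfl, h1⟩
      · exact ⟨y, rfl, s, h1.symm⟩
      · exact absurd (List.suffix_replicate_iff.1 ⟨y, h1.symm⟩).2 hpa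
    have hy : y ≠ [] := by
      rintro rfl
      simp at hpa
    have hyE := (h.endsOff_blocks (k := q - 1) (by omega) (by omega)).of_suffix hy hyB
    have hpr' : y ++ List.replicate t a ++ r = z := hpr
    obtain ⟨k, hk1, hkq, rfl, htk⟩ :=
      h.exists_blocks_of_prefix hyE (by omega) ⟨r, hpr'⟩
    apply hfull
    refine List.IsPrefix.trans ?_ hr
    rcases Nat.lt_or_ge (k + 1) q with hk | hk
    -- Otherwise x_{k+1} is a candidate, since t ≤ x_{k+1} and x₁ ≤ t, and then it is less than t.
    · have hxk : x q ≤ x (k + 1) := by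
        by_contra! hlt
        have hkind : k ∈ indF F a q x β := by
          refine (h.mem_indF_iff (by omega) hzF).2 ⟨hkq, hyB, ?_⟩
          have h1 := (blocks_prefix a x β (show k + 1 ≤ q - 1 by omega)).length_le
          rw [blocks_succ] at h1
          have h2 := List.length_pos_of_ne_nil (h.ne_nil (k + 1) (by omega) hk)
          simp only [List.length_append] at h1
          omega
        have := hmax _ ⟨k, hkind, hk1, by omega, hlt, rfl⟩
        omega
      obtain ⟨e, r', -, hz⟩ := h.exists_eq_append hk
      rw [← hpr', List.append_assoc] at hz
      have hz' := List.append_cancel_left hz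
      rw [show x (k + 1) = t + (x q - t) + (x (k + 1) - x q) by omega, List.replicate_add,
        List.replicate_add, List.append_assoc, List.append_assoc] at hz'
      rw [List.append_cancel_left hz']
      exact List.prefix_append _ _
    · obtain rfl : k = q - 1 := by omega
      have hz := hpr'.trans h.eq
      rw [show x q = t + (x q - t) by omega, List.append_assoc, List.replicate_add] at hz
      rw [List.append_cancel_left (List.append_cancel_left hz)]

/-- Below level `ℓ(p_{q-1}) + x*`, the two states at a level have different continuations. -/
theorem exists_not_append_mem_ftcs_iff (h : IsParse a z q x β) (hx : x 1 < x q)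
    {F : Set (List α)} (hF : F = {List.replicate z.length a, z}) {l : ℕ}
    (hl : l < threshold F a q x β) (hxl : x 1 < l) (hlz : l < z.length) :
    ∃ w, ¬ (List.replicate l a ++ w ∈ ftcs F ↔ z.take l ++ w ∈ ftcs F) := by
  have hq := h.two_le
  have hx1 := h.pos 1 le_rfl (by omega)
  have hzF : z ∈ F := by simp [hF]
  have hlen := h.length_eq
  have hxb := h.lt_length_blocks (k := q - 1) (by omega) (by omega)
  rcases Nat.lt_or_ge l (blocks a x β (q - 1)).length with hlb | hlb
  -- Inside B: complete the prefix of z itself; after a^l this completion is harmless.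
  · refine ⟨z.drop l, fun hiff => ?_⟩
    have h1 := replicate_append_drop_mem_ftcs h.getElem?_first_ne hxl
      (show l ≤ (blocks a x β (q - 1)).length - 1 by omega) (by omega) h.getElem?_last_ne
    rw [← hF, hiff, List.take_append_drop] at h1
    exact h1 z hzF List.infix_rfl
  rcases Nat.lt_or_ge l ((blocks a x β (q - 1)).length + x 1) with hlx | hlx
  -- Here t < x₁: a^l supplies the whole first run of z, the tail a^t does not.
  · refine ⟨z.drop (x 1), fun hiff => ?_⟩
    have h1 := take_append_drop_mem_ftcs (z := z) (fun i hi => h.getElem?_of_lt hi)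
      h.getElem?_first_ne hxb h.getElem?_last_ne (fun i => h.getElem?_tail) hlb hlx hlz
    rw [← hF, ← hiff] at h1
    refine h1 z hzF ?_
    have h2 : z = List.replicate (x 1) a ++ z.drop (x 1) := by
      conv_lhs => rw [← List.take_append_drop (x 1) z]
      rw [List.prefix_iff_eq_take.1 ((h.replicate_prefix_iff _).2 le_rfl)]
      simp
    conv_lhs => rw [h2]
    exact append_infix_of_suffix_prefix (List.suffix_replicate_iff.2 (by simp; omega))
      List.prefix_rfl
  · obtain ⟨t, rfl⟩ := Nat.exists_eq_add_of_le hlb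
    have ht : t ≤ xStar F a q x β := by simp [threshold, pref] at hl; omega
    have hne : (candidates F a q x β).Nonempty := by
      by_contra hne
      rw [xStar, if_neg hne] at ht
      omega
    rw [xStar, if_pos hne] at ht
    obtain ⟨k, hk, hk0, -, hkq, hkx⟩ := Nat.sSup_mem hne (bddAbove_candidates F)
    rw [hkx] at ht
    obtain ⟨hkq', hsuf, hlt⟩ := (h.mem_indF_iff (by omega) hzF).1 hk
    have hk1 : k + 1 < q := by
      by_contra! hge
      obtain rfl : k = q - 1 := by omega
      omega
    have hxk := h.lt_length_blocks hk0 hkq'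
    have hkz : (blocks a x β k).length + x (k + 1) < z.length := by
      have h1 := (blocks_prefix a x β (show k + 1 ≤ q - 1 by omega)).length_le
      rw [blocks_succ] at h1
      simp only [List.length_append, List.length_replicate] at h1
      omega
    -- With x_{k+1} = x*, the suffix B_k a^t of B a^t is completed to z. After a^l the run of a has
    -- length |B| + x_{k+1} < n, too short for a^n.
    refine ⟨z.drop ((blocks a x β k).length + t), fun hiff => ?_⟩
    have h1 := replicate_append_drop_mem_ftcs' (z := z) (m := x 1)
      (l := (blocks a x β (q - 1)).length + t) (d := (blocks a x β k).length + t)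
      (by omega) h.getElem?_first_ne (by omega) hkz (h.getElem?_ne hk1) (by omega) (by omega)
    rw [← hF, hiff, h.take_eq (by omega)] at h1
    refine h1 z hzF ?_
    have h2 : z = (blocks a x β k ++ List.replicate t a) ++
        z.drop ((blocks a x β k).length + t) := by
      obtain ⟨e, r, -, hz⟩ := h.exists_eq_append hk1
      have h3 : blocks a x β k ++ List.replicate t a <+: z := by
        rw [hz, show x (k + 1) = t + (x (k + 1) - t) by omega, List.replicate_add]
        exact ⟨List.replicate (x (k + 1) - t) a ++ e :: r, by simp only [List.append_assoc]⟩
      conv_lhs => rw [← List.take_append_drop ((blocks a x β k).length + t) z]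
      have h4 := List.prefix_iff_eq_take.1 h3
      simp only [List.length_append, List.length_replicate] at h4
      rw [h4]
    conv_lhs => rw [h2]
    obtain ⟨s, hs⟩ := hsuf
    exact append_infix_of_suffix_prefix ⟨s, by rw [← hs]; simp⟩ List.prefix_rfl

end IsParse

end CMR

/-! ### Equivalence classes of states and the Shannon cover -/

namespace CMR

universe u

variable {α : Type u}

theorem eq_replicate_or_eq_take {a : α} {n : ℕ} {z : List α} {F : Set (List α)}
    (hF : F = {List.replicate n a, z}) {u : List α} (hu : IsState F u) :
    u = List.replicate u.length a ∨ u = z.take u.length := by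
  subst hF
  obtain ⟨y, rfl | rfl, h⟩ := hu
  · exact Or.inl (List.prefix_replicate_iff.1 h).2
  · exact Or.inr (List.prefix_iff_eq_take.1 h)

/-- A word completing t to a forbidden word has length n - |t|; after a shorter state the total is
below n, so no forbidden word fits. -/
theorem length_le_of_followerSet_eq {F : Set (List α)} (hF : F.Nonempty) {n : ℕ}
    (hn : ∀ x ∈ F, x.length = n) {s t : State F}
    (h : (cmr F).followerSet s = (cmr F).followerSet t) : t.1.length ≤ s.1.length := by
  by_contra! hlt
  obtain ⟨y, hy, w, rfl⟩ := t.2.1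
  have h1 : w ∈ (cmr F).followerSet s := by
    rw [mem_cmr_followerSet hF hn]
    intro y hyF hyw
    have h2 := hyw.length_le
    have h3 := hn _ hy
    have h4 := hn _ hyF
    simp only [List.length_append] at h2 h3
    omega
  rw [h, mem_cmr_followerSet hF hn] at h1
  exact h1 _ hy List.infix_rfl

/-- A block of `n` symbols `b`, where no word of `F` starts or ends in `b`, joins any two words
of the constrained system. -/
theorem append_replicate_append_mem_ftcs {F : Set (List α)} {n : ℕ} (hn : ∀ x ∈ F, x.length = n)
    (hpos : 0 < n) {b : α} (hhead : ∀ x ∈ F, x.head? ≠ some b)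
    (hlast : ∀ x ∈ F, x.getLast? ≠ some b) {u w : List α}
    (hu : u ∈ ftcs F) (hw : w ∈ ftcs F) : u ++ List.replicate n b ++ w ∈ ftcs F := by
  intro y hy h
  have hyn := hn y hy
  have hsuf : ∀ p r, p ≠ [] → p ++ r = y → p ≠ List.replicate p.length b := by
    rintro (_ | ⟨c, p⟩) r hp rfl hb
    · exact hp rfl
    · apply hhead _ hy
      rw [List.length_cons, List.replicate_succ, List.cons.injEq] at hb
      simp [hb.1]
  have hpre : ∀ p r, r ≠ [] → p ++ r = y → r ≠ List.replicate r.length b := by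
    rintro p r hr rfl hb
    apply hlast _ hy
    rcases List.eq_nil_or_concat r with rfl | ⟨r, c, rfl⟩
    · exact absurd rfl hr
    · have hc : c ∈ r.concat c := by simp
      rw [hb] at hc
      have := List.eq_of_mem_replicate hc
      simp [this]
  have hmid : ∀ v, v ∈ ftcs F → ¬ y <:+: v ++ List.replicate n b := by
    intro v hv h
    rcases infix_append_cases h with h | h | ⟨p, r, h1, -, hr, -, h2⟩
    · exact hv y hy h
    · have h1 := h.eq_of_length_le (by simp [hyn])
      refine hpre [] y ?_ rfl (by rw [hyn]; exact h1)
      rintro rfl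
      simp at hyn
      omega
    · exact hpre p r hr h1.symm (List.prefix_replicate_iff.1 h2).2
  rcases infix_append_cases h with h | h | ⟨p, r, rfl, hp, hr, h2, h3⟩
  · exact hmid u hu h
  · exact hw y hy h
  -- As r is nonempty, p is shorter than n and so lies entirely in the block of b.
  · have hpl : p.length ≤ (List.replicate n b).length := by
      simp only [List.length_append, List.length_replicate] at hyn ⊢
      omega
    have hps : p <:+ List.replicate n b :=
      List.suffix_of_suffix_length_le h2 (List.suffix_append _ _) hpl
    exact hsuf p r hp rfl (List.suffix_replicate_iff.1 hps).2

namespace IsParse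

variable {a : α} {z : List α} {q : ℕ} {x : ℕ → ℕ} {β : ℕ → List α}

theorem cmr_followerSet_eq (h : IsParse a z q x β) {F : Set (List α)}
    (hF : F = {List.replicate z.length a, z}) {s t : State F} (hst : s.1.length = t.1.length)
    (hl : threshold F a q x β ≤ s.1.length) :
    (cmr F).followerSet s = (cmr F).followerSet t := by
  have hne : F.Nonempty := ⟨z, by simp [hF]⟩
  have hn : ∀ y ∈ F, y.length = z.length := by
    rintro y hy
    rw [hF] at hy
    rcases hy with rfl | rfl <;> simp
  have hlz := length_lt_of_isState hn s.2.1 s.2.2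
  have key : ∀ r : State F, r.1.length = s.1.length → ∀ w,
      r.1 ++ w ∈ ftcs F ↔ List.replicate s.1.length a ++ w ∈ ftcs F := by
    intro r hr w
    rcases eq_replicate_or_eq_take hF r.2.1 with h1 | h1
    · rw [h1, hr]
    · rw [h1, hr, h.append_mem_ftcs_iff hF hl hlz]
  ext w
  rw [mem_cmr_followerSet hne hn, mem_cmr_followerSet hne hn, key s rfl, key t hst.symm]

theorem eq_or_threshold_le (h : IsParse a z q x β) (hx : x 1 < x q) {F : Set (List α)}
    (hF : F = {List.replicate z.length a, z}) {s t : State F}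
    (hst : (cmr F).followerSet s = (cmr F).followerSet t) :
    s = t ∨ s.1.length = t.1.length ∧ threshold F a q x β ≤ s.1.length := by
  have hne : F.Nonempty := ⟨z, by simp [hF]⟩
  have hn : ∀ y ∈ F, y.length = z.length := by
    rintro y hy
    rw [hF] at hy
    rcases hy with rfl | rfl <;> simp
  have hlen : s.1.length = t.1.length :=
    le_antisymm (length_le_of_followerSet_eq hne hn hst.symm)
      (length_le_of_followerSet_eq hne hn hst)
  by_contra! hcon
  obtain ⟨hne', hlt⟩ := hcon
  have hlz := length_lt_of_isState hn s.2.1 s.2.2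
  have hiff : ∀ w, s.1 ++ w ∈ ftcs F ↔ t.1 ++ w ∈ ftcs F := fun w => by
    rw [← mem_cmr_followerSet hne hn, ← mem_cmr_followerSet hne hn, hst]
  -- Up to level x₁ both forbidden words have the same prefix a^l, so a level holds a single state.
  have hsmall : x 1 < s.1.length := by
    by_contra! hle
    have h0 := List.prefix_iff_eq_take.1 ((h.replicate_prefix_iff _).2 hle)
    rw [List.length_replicate] at h0
    have key : ∀ r : State F, r.1.length = s.1.length → r.1 = List.replicate s.1.length a := by
      intro r hr
      rcases eq_replicate_or_eq_take hF r.2.1 with h1 | h1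
      · rw [h1, hr]
      · rw [h1, hr, h0]
    exact hne' (Subtype.ext ((key s rfl).trans (key t hlen.symm).symm))
  obtain ⟨w, hw⟩ := h.exists_not_append_mem_ftcs_iff hx hF (hlt hlen) hsmall hlz
  have hs := eq_replicate_or_eq_take hF s.2.1
  have ht := eq_replicate_or_eq_take hF t.2.1
  rw [← hlen] at ht
  rcases hs with hs | hs <;> rcases ht with ht | ht
  · exact hne' (Subtype.ext (hs.trans ht.symm))
  · exact hw (by rw [← hs, ← ht]; exact hiff w)
  · exact hw (by rw [← hs, ← ht]; exact (hiff w).symm)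
  · exact hne' (Subtype.ext (hs.trans ht.symm))

theorem levels_equiv_iff (h : IsParse a z q x β) (hx : x 1 < x q) {F : Set (List α)}
    (hF : F = {List.replicate z.length a, z}) {l : ℕ} (hl : (pref a x β 1).length ≤ l)
    (hlz : l < z.length) :
    (∀ s ∈ level F l, ∀ t ∈ level F l, (cmr F).followerSet s = (cmr F).followerSet t) ↔
      threshold F a q x β ≤ l := by
  constructor
  · intro hall
    have hq := h.two_le
    have hxl : x 1 < l := by
      have := h.lt_length_blocks (k := 1) le_rfl (by omega)
      simp only [pref, List.length_append] at hl
      omega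
    have hnot : ∀ u : List α, u.length = l → u ∉ F := by
      rintro u hu hm
      rw [hF] at hm
      rcases hm with rfl | rfl
      · simp at hu; omega
      · omega
    let s : State F := ⟨List.replicate l a,
      ⟨List.replicate z.length a, by simp [hF],
        List.prefix_replicate_iff.2 (by simp; omega)⟩, hnot _ (by simp)⟩
    let t : State F := ⟨z.take l, ⟨z, by simp [hF], List.take_prefix _ _⟩,
      hnot _ (by simp; omega)⟩
    have hs : s ∈ level F l := by simp [level, s]
    have ht : t ∈ level F l := by simp [level, t]; omega
    rcases h.eq_or_threshold_le hx hF (hall s hs t ht) with h1 | ⟨-, h1⟩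
    · exfalso
      apply h.getElem?_first_ne
      have h2 : List.replicate l a = z.take l := congrArg Subtype.val h1
      rw [← List.getElem?_take_of_lt hxl, ← h2, List.getElem?_replicate, if_pos hxl]
    · simpa [s] using h1
  · intro hl s hs t ht
    have hs : s.1.length = l := hs
    have ht : t.1.length = l := ht
    exact h.cmr_followerSet_eq hF (hs.trans ht.symm) (hs ▸ hl)

theorem merge_isShannonCover [Fintype α] (h : IsParse a z q x β) (hx : x 1 < x q)
    {F : Set (List α)} (hF : F = {List.replicate z.length a, z}) {r : State F → State F}
    (hr : LabeledGraph.IsSelection (levelSetoid F (threshold F a q x β)) r) :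
    ((cmr F).merge r).IsShannonCover (ftcs F) ∧
      ∀ (W : Type) (H : LabeledGraph α W), H.IsShannonCover (ftcs F) →
        H.Isomorphic ((cmr F).merge r) := by
  have hq := h.two_le
  have hne : F.Nonempty := ⟨z, by simp [hF]⟩
  have hn : ∀ y ∈ F, y.length = z.length := by
    rintro y hy
    rw [hF] at hy
    rcases hy with rfl | rfl <;> simp
  have hlen := h.length_eq
  have hpos : 0 < z.length := by omega
  obtain ⟨hr1, hr2⟩ := hr
  have hrr : ∀ s, r (r s) = r s := fun s => (hr2 _ _ (hr1 s)).symm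
  have hrf : ∀ s, (cmr F).followerSet (r s) = (cmr F).followerSet s := by
    intro s
    rcases hr1 s with h1 | ⟨h1, h2⟩
    · rw [← h1]
    · exact (h.cmr_followerSet_eq hF h1 h2).symm
  have hMf := LabeledGraph.merge_followerSet hrf hrr
  have hMdet := LabeledGraph.merge_deterministic (cmr_deterministic F) r
  have hsep : ∀ s t, ((cmr F).merge r).followerSet s = ((cmr F).merge r).followerSet t →
      s = t := by
    rintro ⟨s, hs⟩ ⟨t, ht⟩ hst
    rw [hMf, hMf] at hst
    have := hr2 s t (h.eq_or_threshold_le hx hF hst)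
    exact Subtype.ext (hs.symm.trans (this.trans ht))
  have hsF : ∀ s : State F, ∀ v, v <+: s.1 → v ∉ F := fun s v hv hvF => by
    have h1 := length_lt_of_isState hn s.2.1 s.2.2
    have h2 := hn v hvF
    have h3 := hv.length_le
    omega
  have hnil : [] ∉ F := fun h0 => by
    have := hn _ h0
    simp at this
    omega
  let ε : State F := ⟨[], isState_nil hne, hnil⟩
  have hε : (cmr F).followerSet ε = ftcs F := by
    ext w
    rw [mem_cmr_followerSet hne hn, List.nil_append]
  let s₀ : {s // r s = s} := ⟨r ε, hrr ε⟩
  have hs₀ : ((cmr F).merge r).followerSet s₀ = ftcs F := by rw [hMf, hrf, hε]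
  have hsub : ∀ s, ((cmr F).merge r).followerSet s ⊆ ftcs F := by
    intro s w hw
    rw [hMf, mem_cmr_followerSet hne hn] at hw
    exact ftcs_of_infix hw (List.suffix_append _ _).isInfix
  have hreach : ∀ s, ∃ w, ((cmr F).merge r).Path s₀ w s := by
    intro s
    have hp := cmr_path_isState hne s.1.1 s.1.2.1 (hsF s.1)
    have hw : s.1.1 ∈ ((cmr F).merge r).followerSet s₀ := by
      rw [hMf, hrf]
      exact ⟨_, hp⟩
    obtain ⟨t, ht⟩ := hw
    refine ⟨s.1.1, ?_⟩
    -- Reading the word s from the merged initial state ends at a state with the follower set of s,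
    -- which is s by separation.
    suffices hts : t = s by rw [hts] at ht; exact ht
    apply hsep
    rw [hMdet.followerSet_of_path ht, hMf, hMf, hrf,
      ← (cmr_deterministic F).followerSet_of_path hp]
  have hsys : ((cmr F).merge r).system = ftcs F :=
    Set.Subset.antisymm (fun w ⟨s, hs⟩ => hsub s hs) fun w hw => ⟨s₀, hs₀ ▸ hw⟩
  have : Finite (State F) := finite_state hn
  -- The joining letter b ends the first β, so b ≠ a. Both forbidden words begin and end in a, z
  -- because x₁ and x_q are positive.
  obtain ⟨y, b, -, hb⟩ := h.endsOff_blocks (k := 1) le_rfl (by omega)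
  have hza : z.head? = some a := by
    rw [List.head?_eq_getElem?, h.getElem?_of_lt (h.pos 1 le_rfl (by omega))]
  have hzl : z.getLast? = some a := by
    rw [List.getLast?_eq_getElem?, h.getElem?_tail (by omega) (by omega)]
  refine LabeledGraph.isShannonCover_and_unique hMdet hsys s₀ hs₀ hreach hsep
    (List.replicate z.length b) fun u hu w hw =>
      append_replicate_append_mem_ftcs hn hpos ?_ ?_ hu hw
  · rintro y hy
    rw [hF] at hy
    rcases hy with rfl | rfl
    · simp [List.head?_replicate, Ne.symm hb]
    · simp [hza, Ne.symm hb]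
  · rintro y hy
    rw [hF] at hy
    rcases hy with rfl | rfl
    · simp [List.getLast?_replicate, Ne.symm hb]
    · simp [hzl, Ne.symm hb]

end IsParse

end CMR

theorem theorem5p3 {α : Type*} [Fintype α] (hα : 3 ≤ Fintype.card α)
    (a : α) (n : ℕ) (z₁ z₂ : List α)
    (hz₁ : z₁ = List.replicate n a) (hz₂ : z₂.length = n)
    (F : Set (List α)) (hF : F = {z₁, z₂})
    (q : ℕ) (x : ℕ → ℕ) (β : ℕ → List α)
    (hparse : CMR.IsParse a z₂ q x β) (hx : x 1 < x q) :
    -- the states at level `l ≥ ℓ(p₁)` are follower-set equivalent iff `l ≥ ℓ(p_{q-1}) + x*`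
    (∀ l, (CMR.pref a x β 1).length ≤ l → l < n →
      ((∀ s ∈ CMR.level F l, ∀ t ∈ CMR.level F l,
          (CMR.cmr F).followerSet s = (CMR.cmr F).followerSet t) ↔
        CMR.threshold F a q x β ≤ l)) ∧
    -- merging the states at each level `l ≥ ℓ(p_{q-1}) + x*`, whichever of them are kept,
    -- gives the Shannon cover, which is unique up to isomorphism
    (∀ r : CMR.State F → CMR.State F,
      CMR.LabeledGraph.IsSelection (CMR.levelSetoid F (CMR.threshold F a q x β)) r →
        ((CMR.cmr F).merge r).IsShannonCover (CMR.ftcs F) ∧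
        ∀ (W : Type) (H : CMR.LabeledGraph α W), H.IsShannonCover (CMR.ftcs F) →
          H.Isomorphic ((CMR.cmr F).merge r)) := by
  subst hz₁ hz₂
  exact ⟨fun l hl hln => hparse.levels_equiv_iff hx hF hl hln,
    fun r hr => hparse.merge_isShannonCover hx hF hr⟩
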